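/- Let $d\ge 1$ be an integer. For $f\in L^2(\mathbb{R}^d)$ let $\widehat f$ denote its ($L^2$-)Fourier transform, normalized by $\widehat f(\omega)=\int_{\mathbb{R}^d} f(x)e^{-2\pi i\langle x,\omega\rangle}\,\mathrm dx$ for integrable $f$, and for $s>0$ let $$H^s(\mathbb{R}^d)=\Big\{f\in L^2(\mathbb{R}^d)\ \Big|\ \|f\|_{H^s}:=\Big(\int_{\mathbb{R}^d}|\widehat f(\omega)|^2(1+|\omega|^2)^s\,\mathrm d\omega\Big)^{1/2}<\infty\Big\}.$$ Write $\langle x\rangle=(1+|x|^2)^{1/2}$. For $K>0$ let $\mathcal{C}^K_{\mathrm{CART}}$ be the class of cartoon functions of size $K$, that is, of all functions $f_1+\mathbf 1_D f_2:\mathbb{R}^d\to\mathbb{C}$ such that - $D\subseteq\mathbb{R}^d$ is a compact set whose topological boundary $\partial D$ is a compact topologically embedded $C^2$-hypersurface of $\mathbb{R}^d$ without boundary (i.e. the image of a $(d-1)$-dimensional $C^2$-manifold without boundary under a $C^2$-immersion into $\mathbb{R}^d$ that is a homeomorphism onto its image; the empty hypersurface is allowed), with $(d-1)$-dimensional volume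 $\mathrm{vol}^{d-1}(\partial D)\le K$; - $f_1,f_2\in H^{1/2}(\mathbb{R}^d)\cap C^1(\mathbb{R}^d,\mathbb{C})$, with $|\nabla f_i(x)|\le K\langle x\rangle^{-d}$ for all $x\in\mathbb{R}^d$ and $i=1,2$, and $\|f_2\|_{L^\infty}\le K$. Then, for every $K>0$ and every $s\in(0,1/2)$, $$\mathcal{C}^K_{\mathrm{CART}}\subseteq H^s(\mathbb{R}^d).$$ -/

import Mathlib

open MeasureTheory Set Topology Manifold
open scoped ENNReal FourierTransform

noncomputable section

/-- The `H^s`-norm `(∫ |f̂(ξ)|² (1 + |ξ|²)^s dξ)^(1/2)` of `f ∈ L²(ℝ^d)`, with values in `[0, ∞]`.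
Here `f̂` is the `L²`-Fourier transform, normalized by
`f̂(ξ) = ∫ f(x) exp(-2πi⟨x, ξ⟩) dx` for integrable `f`. -/
def sobolevENorm {d : ℕ} (s : ℝ)
    (f : Lp ℂ 2 (volume : Measure (EuclideanSpace ℝ (Fin d)))) : ℝ≥0∞ :=
  (∫⁻ ξ : EuclideanSpace ℝ (Fin d),
    ‖(𝓕 f : Lp ℂ 2 (volume : Measure (EuclideanSpace ℝ (Fin d)))) ξ‖ₑ ^ 2 *
      ENNReal.ofReal ((1 + ‖ξ‖ ^ 2) ^ s)) ^ (1 / 2 : ℝ)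

/-- The functions `f : ℝ^d → ℂ` that represent an element of the Sobolev space `H^s(ℝ^d)`:
those in `L²` with finite `H^s`-norm. -/
def sobolevSpace (d : ℕ) (s : ℝ) : Set (EuclideanSpace ℝ (Fin d) → ℂ) :=
  {f | ∃ hf : MemLp f 2 volume, sobolevENorm s (hf.toLp f) < ⊤}

/-- The gradient `∇f(x) = (∂₁f(x), …, ∂_d f(x)) ∈ ℂ^d`, with the Euclidean norm on `ℂ^d`. -/
def complexGradient {d : ℕ} (f : EuclideanSpace ℝ (Fin d) → ℂ) (x : EuclideanSpace ℝ (Fin d)) :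
    EuclideanSpace ℂ (Fin d) :=
  WithLp.toLp 2 fun i => fderiv ℝ f x (EuclideanSpace.single i 1)

/-- The Japanese bracket `⟨x⟩ = (1 + |x|²)^(1/2)`. -/
def japaneseBracket {d : ℕ} (x : EuclideanSpace ℝ (Fin d)) : ℝ :=
  Real.sqrt (1 + ‖x‖ ^ 2)

/-- `S ⊆ ℝ^d` is a topologically embedded `C²`-hypersurface without boundary: the image of a
`(d-1)`-dimensional boundaryless `C²`-manifold under a `C²`-embedding (that is, a `C²`-immersion
which is a homeomorphism onto its image). -/
def IsEmbeddedC2Hypersurface {d : ℕ} (S : Set (EuclideanSpace ℝ (Fin d))) : Prop :=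
  ∃ (M : Type) (_ : TopologicalSpace M) (_ : ChartedSpace (EuclideanSpace ℝ (Fin (d - 1))) M)
    (_ : IsManifold (𝓡 (d - 1)) 2 M) (ι : M → EuclideanSpace ℝ (Fin d)),
    IsSmoothEmbedding (𝓡 (d - 1)) (𝓡 d) 2 ι ∧ range ι = S

/-- The class of cartoon functions `f₁ + 1_D f₂` on `ℝ^d` of size `K`. The surface measure
`vol^(d-1)` is the `(d-1)`-dimensional Hausdorff measure in the normalization for which it is
Lebesgue measure on `ℝ^(d-1)`; `‖f₂‖_∞` is the essential supremum norm. -/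
def cartoonClass (d : ℕ) (K : ℝ) : Set (EuclideanSpace ℝ (Fin d) → ℂ) :=
  {f | ∃ (f₁ f₂ : EuclideanSpace ℝ (Fin d) → ℂ) (D : Set (EuclideanSpace ℝ (Fin d))),
    f = f₁ + D.indicator f₂ ∧
    IsCompact D ∧
    IsCompact (frontier D) ∧ IsEmbeddedC2Hypersurface (frontier D) ∧
    f₁ ∈ sobolevSpace d (1 / 2) ∧ ContDiff ℝ 1 f₁ ∧
    f₂ ∈ sobolevSpace d (1 / 2) ∧ ContDiff ℝ 1 f₂ ∧
    (∀ x, ‖complexGradient f₁ x‖ ≤ K * japaneseBracket x ^ (-(d : ℤ))) ∧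
    (∀ x, ‖complexGradient f₂ x‖ ≤ K * japaneseBracket x ^ (-(d : ℤ))) ∧
    μHE[d - 1] (frontier D) ≤ ENNReal.ofReal K ∧
    eLpNorm f₂ ⊤ volume ≤ ENNReal.ofReal K}

end

/-! Since `f₁ ∈ H^{1/2} ⊆ H^s`, only the cut-off `g = 1_D f₂` matters. It satisfies `‖g(· + y) -
g‖₂² ≤ C|y|` for `|y| ≤ 1` (`exists_lintegral_translate_indicator_le`): where both points lie in
`D`, the Lipschitz bound for `f₂` gives `O(|y|²)`; where exactly one does, the segment between them
meets `∂D`, so both lie in a tube of radius `|y|` around `∂D`, of volume `O(|y|)`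
(`exists_volume_cthickening_le`).

By Plancherel, `lintegral_fourier_sq_mul_lt_top` turns this into decay of `ĝ`: translating by
`2^{-(k+2)} e_i` detects the frequencies with `|ξ_i| ≈ 2^k`, whose energy is thus `O(2^{-k})`.
Weighted by `2^{2sk}`, these energies are summable because `2s < 1`. -/

/-! ### Plancherel and translations -/

/-- The `L²`-Fourier transform of an integrable `L²` function is given by the Fourier integral. -/
theorem Lp.fourier_toLp_ae_eq {d : ℕ} {g : EuclideanSpace ℝ (Fin d) → ℂ}
    (hg : Integrable g) (hg2 : MemLp g 2) :
    (𝓕 (hg2.toLp g) : Lp ℂ 2 (volume : Measure (EuclideanSpace ℝ (Fin d)))) =ᵐ[volume] 𝓕 g := by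
  have hcont : Continuous (𝓕 g) :=
    VectorFourier.fourierIntegral_continuous Real.continuous_fourierChar
      (L := innerₗ (EuclideanSpace ℝ (Fin d))) continuous_inner hg
  refine ae_eq_of_integral_contDiff_smul_eq
    ((Lp.memLp _).locallyIntegrable (by norm_num)) hcont.locallyIntegrable fun φ hφ hφs ↦ ?_
  have hc : ContDiff ℝ (↑(⊤ : ℕ∞)) (fun x ↦ (φ x : ℂ)) := Complex.ofRealCLM.contDiff.comp hφ
  have hs : HasCompactSupport (fun x ↦ (φ x : ℂ)) := hφs.comp_left (g := ((↑) : ℝ → ℂ)) rfl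
  -- Tested against `ψ`, both transforms become `∫ 𝓕 ψ • g`: one by duality of tempered
  -- distributions, the other by Fubini.
  set ψ := hs.toSchwartzMap hc with hψ
  have h := congrArg (fun T ↦ T ψ) (Lp.fourier_toTemperedDistribution_eq (hg2.toLp g))
  simp only [TemperedDistribution.fourier_apply, Lp.toTemperedDistribution_apply] at h
  have h1 : ∀ x, ψ x = (φ x : ℂ) := fun x ↦ rfl
  simp only [h1, Complex.coe_smul] at h
  rw [← h]
  have h2 : ∫ x, (𝓕 ψ) x • (hg2.toLp g) x = ∫ x, (𝓕 ψ) x • g x :=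
    integral_congr_ae (by filter_upwards [hg2.coeFn_toLp] with x hx; rw [hx])
  rw [h2]
  have h3 := VectorFourier.integral_fourierIntegral_smul_eq_flip Real.continuous_fourierChar
    (L := innerₗ (EuclideanSpace ℝ (Fin d))) continuous_inner (ψ.integrable (μ := volume)) hg
  simp only [h1, Complex.coe_smul, flip_innerₗ] at h3
  exact h3

theorem fourier_translate_sub {d : ℕ} {g : EuclideanSpace ℝ (Fin d) → ℂ}
    (hg : Integrable g) (h ξ : EuclideanSpace ℝ (Fin d)) :
    𝓕 (fun x ↦ g (x + h) - g x) ξ =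
      ((Real.fourierChar (inner ℝ h ξ) : ℂ) - 1) * 𝓕 g ξ := by
  have h1 := congrFun (VectorFourier.fourierIntegral_comp_add_right Real.fourierChar volume
    (innerₗ (EuclideanSpace ℝ (Fin d))) g h) ξ
  have h2 : 𝓕 (fun x ↦ g (x + h)) ξ = (Real.fourierChar (inner ℝ h ξ) : ℂ) * 𝓕 g ξ := h1
  rw [sub_mul, one_mul, ← h2]
  simp only [Real.fourier_eq]
  rw [← integral_sub ((Real.fourierIntegral_convergent_iff ξ).2 (hg.comp_add_right h))
    ((Real.fourierIntegral_convergent_iff ξ).2 hg)]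
  simp only [smul_sub]

theorem lintegral_enorm_fourier_sq {d : ℕ} {g : EuclideanSpace ℝ (Fin d) → ℂ}
    (hg : Integrable g) (hg2 : MemLp g 2) :
    ∫⁻ ξ, ‖𝓕 g ξ‖ₑ ^ 2 = ∫⁻ x, ‖g x‖ₑ ^ 2 := by
  have h1 : ‖𝓕 (hg2.toLp g)‖ₑ = ‖hg2.toLp g‖ₑ := by
    rw [← ofReal_norm, ← ofReal_norm, Lp.norm_fourier_eq]
  rw [Lp.enorm_def, Lp.enorm_def, eLpNorm_congr_ae (Lp.fourier_toLp_ae_eq hg hg2),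
    eLpNorm_congr_ae hg2.coeFn_toLp] at h1
  have h2 : ∀ f : EuclideanSpace ℝ (Fin d) → ℂ, ∫⁻ x, ‖f x‖ₑ ^ 2 = eLpNorm f 2 volume ^ 2 := by
    intro f
    simpa using (eLpNorm_nnreal_pow_eq_lintegral (f := f) (μ := volume) (p := 2) two_ne_zero).symm
  rw [h2, h2, h1]

theorem lintegral_translate_sub {d : ℕ} {g : EuclideanSpace ℝ (Fin d) → ℂ}
    (hg : Integrable g) (hg2 : MemLp g 2) (h : EuclideanSpace ℝ (Fin d)) :
    ∫⁻ ξ, ‖(Real.fourierChar (inner ℝ h ξ) : ℂ) - 1‖ₑ ^ 2 * ‖𝓕 g ξ‖ₑ ^ 2 =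
      ∫⁻ x, ‖g (x + h) - g x‖ₑ ^ 2 := by
  have h2 : MemLp (fun x ↦ g (x + h)) 2 :=
    hg2.comp_measurePreserving (measurePreserving_add_right volume h)
  have h4 := lintegral_enorm_fourier_sq ((hg.comp_add_right h).sub hg) (h2.sub hg2)
  refine Eq.trans (lintegral_congr fun ξ ↦ ?_) h4
  have h3 : 𝓕 ((fun x ↦ g (x + h)) - g) ξ = _ := fourier_translate_sub hg h ξ
  rw [h3, enorm_mul, mul_pow]

/-! ### From translation modulus to Fourier decay -/

theorem one_le_norm_fourierChar_sub_one_sq {a : ℝ} (h1 : 1 / 4 ≤ |a|) (h2 : |a| ≤ 1 / 2) :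
    1 ≤ ‖(Real.fourierChar a : ℂ) - 1‖ ^ 2 := by
  have h3 : Real.cos (2 * Real.pi * a) ≤ 0 := by
    rw [← Real.cos_abs, abs_mul, abs_of_pos Real.two_pi_pos]
    apply Real.cos_nonpos_of_pi_div_two_le_of_le <;> nlinarith [Real.pi_pos]
  rw [Real.fourierChar_apply, Complex.exp_mul_I, ← Complex.normSq_eq_norm_sq, Complex.normSq_apply]
  simp only [← Complex.ofReal_cos, ← Complex.ofReal_sin, Complex.sub_re, Complex.add_re,
    Complex.mul_re, Complex.ofReal_re, Complex.I_re, Complex.ofReal_im, Complex.I_im,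
    Complex.one_re, Complex.sub_im, Complex.add_im, Complex.mul_im, Complex.one_im]
  nlinarith [Real.sin_sq_add_cos_sq (2 * Real.pi * a)]

/-- A single term of the series suffices: if `2^n ≤ |a| < 2^(n+1)`, scaling by `2^{-(n+2)}` moves
`|a|` into `[1/4, 1/2)`, where the character is at distance at least `1` from `1`. The summand `1`
covers `|a| ≤ 1`. -/
theorem rpow_le_one_add_tsum_fourierChar {s : ℝ} (hs : 0 ≤ s) (a : ℝ) :
    (‖a‖ₑ ^ 2) ^ s ≤ 1 + ∑' k : ℕ, ((2 : ℝ≥0∞) ^ (2 * s)) ^ (k + 1) *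
      ‖(Real.fourierChar ((1 / 2) ^ (k + 2) * a) : ℂ) - 1‖ₑ ^ 2 := by
  rcases le_total ‖a‖ₑ 1 with ha | ha
  · refine le_trans ?_ le_self_add
    exact ENNReal.rpow_le_one (pow_le_one₀ zero_le ha) hs
  · refine le_trans ?_ le_add_self
    have ha' : 1 ≤ |a| := by
      rw [← ofReal_norm] at ha
      simpa using ha
    obtain ⟨n, hn1, hn2⟩ := exists_nat_pow_near ha' one_lt_two
    refine le_trans ?_ (ENNReal.le_tsum n)
    have h1 : (1 : ℝ≥0∞) ≤ ‖(Real.fourierChar ((1 / 2) ^ (n + 2) * a) : ℂ) - 1‖ₑ ^ 2 := by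
      rw [← ofReal_norm, ← ENNReal.ofReal_pow (norm_nonneg _), ENNReal.one_le_ofReal]
      have hp : (0 : ℝ) < 2 ^ n := by positivity
      have e : |(1 / 2 : ℝ) ^ (n + 2) * a| = |a| / (4 * 2 ^ n) := by
        rw [abs_mul, abs_of_pos (by positivity), one_div, inv_pow, pow_add]
        field_simp; norm_num
      apply one_le_norm_fourierChar_sub_one_sq <;> rw [e]
      · rw [le_div_iff₀ (by positivity)]; linarith
      · rw [div_le_iff₀ (by positivity)]; rw [pow_succ] at hn2; linarith
    refine le_trans ?_ (le_mul_of_one_le_right zero_le h1)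
    have h2 : ‖a‖ₑ ≤ 2 ^ (n + 1) := by
      rw [← ofReal_norm]
      exact (ENNReal.ofReal_le_ofReal hn2.le).trans (by simp [ENNReal.ofReal_pow])
    have e : ((2 : ℝ≥0∞) ^ (2 * s)) ^ (n + 1) = (((2 : ℝ≥0∞) ^ (n + 1)) ^ 2) ^ s := by
      simp only [← ENNReal.rpow_natCast, ← ENNReal.rpow_mul]
      congr 1; push_cast; ring
    rw [e]
    gcongr

/-- Subadditivity of `t ↦ t^s` for `s ≤ 1` separates the coordinates, so translations along the axes
are enough. -/
theorem ofReal_one_add_norm_sq_rpow_le {d : ℕ} {s : ℝ} (hs : 0 < s) (hs1 : s ≤ 1)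
    (ξ : EuclideanSpace ℝ (Fin d)) :
    ENNReal.ofReal ((1 + ‖ξ‖ ^ 2) ^ s) ≤ 1 + ∑ i, (‖ξ i‖ₑ ^ 2) ^ s := by
  rw [← ENNReal.ofReal_rpow_of_pos (by positivity), ENNReal.ofReal_add zero_le_one (by positivity),
    ENNReal.ofReal_one, EuclideanSpace.norm_sq_eq, ENNReal.ofReal_sum_of_nonneg
      (fun _ _ ↦ by positivity)]
  have h : ∀ x : ℝ, ENNReal.ofReal (‖x‖ ^ 2) = ‖x‖ₑ ^ 2 := fun x ↦ by
    rw [ENNReal.ofReal_pow (norm_nonneg _), ofReal_norm]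
  simp only [h]
  refine (ENNReal.rpow_add_le_add_rpow _ _ hs.le hs1).trans ?_
  rw [ENNReal.one_rpow]
  gcongr
  exact Finset.le_sum_of_subadditive (fun x : ℝ≥0∞ ↦ x ^ s) (ENNReal.zero_rpow_of_pos hs).le
    (fun a b ↦ ENNReal.rpow_add_le_add_rpow a b hs.le hs1) _ _

theorem lintegral_fourier_sq_mul_lt_top {d : ℕ} {s : ℝ} (hs : 0 < s) (hs2 : s < 1 / 2)
    {g : EuclideanSpace ℝ (Fin d) → ℂ} (hg : Integrable g) (hg2 : MemLp g 2) {C : ℝ≥0∞}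
    (hC : C ≠ ⊤) (h : ∀ y : EuclideanSpace ℝ (Fin d), ‖y‖ ≤ 1 →
      ∫⁻ x, ‖g (x + y) - g x‖ₑ ^ 2 ≤ C * ‖y‖ₑ) :
    ∫⁻ ξ, ‖𝓕 g ξ‖ₑ ^ 2 * ENNReal.ofReal ((1 + ‖ξ‖ ^ 2) ^ s) < ⊤ := by
  have hcont : Continuous (𝓕 g) :=
    VectorFourier.fourierIntegral_continuous Real.continuous_fourierChar
      (L := innerₗ (EuclideanSpace ℝ (Fin d))) continuous_inner hg
  set q : ℝ≥0∞ := 2 ^ (2 * s) with hq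
  -- The ratio of the final geometric series; this is where `s < 1/2` is needed.
  have hq2 : q / 2 < 1 := by
    rw [ENNReal.div_lt_iff (by simp) (by simp), one_mul]
    calc q < (2 : ℝ≥0∞) ^ (1 : ℝ) := ENNReal.rpow_lt_rpow_of_exponent_lt (by simp) (by simp)
          (by linarith)
      _ = 2 := by simp
  have hqt : q ≠ ⊤ := ENNReal.rpow_ne_top_of_nonneg (by positivity) (by simp)
  set c : Fin d → ℕ → EuclideanSpace ℝ (Fin d) → ℝ≥0∞ := fun i k ξ ↦
    ‖(Real.fourierChar ((1 / 2) ^ (k + 2) * ξ i) : ℂ) - 1‖ₑ ^ 2 with hc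
  have hcm : ∀ i k, Measurable (c i k) := by
    intro i k
    have : Continuous fun ξ : EuclideanSpace ℝ (Fin d) ↦
      ‖(Real.fourierChar ((1 / 2) ^ (k + 2) * ξ i) : ℂ) - 1‖ₑ ^ 2 := by
      have := Real.continuous_fourierChar
      fun_prop
    exact this.measurable
  have hFm : Measurable fun ξ ↦ ‖𝓕 g ξ‖ₑ ^ 2 := by
    have : Continuous fun ξ ↦ ‖𝓕 g ξ‖ₑ ^ 2 := by fun_prop
    exact this.measurable
  have hF : ∫⁻ ξ, ‖𝓕 g ξ‖ₑ ^ 2 < ⊤ := by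
    rw [lintegral_enorm_fourier_sq hg hg2]
    have := (eLpNorm_lt_top_iff_lintegral_rpow_enorm_lt_top (by simp) (by simp)).1 hg2.2
    simpa using this
  have hI : ∀ i k, ∫⁻ ξ, ‖𝓕 g ξ‖ₑ ^ 2 * c i k ξ ≤ C * (1 / 2) ^ (k + 2) := by
    intro i k
    have h1 : ‖EuclideanSpace.single i ((1 / 2 : ℝ) ^ (k + 2))‖ₑ = (1 / 2 : ℝ≥0∞) ^ (k + 2) := by
      rw [← ofReal_norm]
      simp [ENNReal.ofReal_inv_of_pos, ENNReal.ofReal_pow, ENNReal.inv_pow]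
    have h2 := h (EuclideanSpace.single i ((1 / 2 : ℝ) ^ (k + 2))) (by
      simp only [PiLp.norm_single, norm_pow]
      exact pow_le_one₀ (by positivity) (by norm_num))
    rw [← lintegral_translate_sub hg hg2, h1] at h2
    refine le_trans (le_of_eq (lintegral_congr fun ξ ↦ ?_)) h2
    rw [mul_comm, EuclideanSpace.inner_single_left]
    simp [hc]
  calc ∫⁻ ξ, ‖𝓕 g ξ‖ₑ ^ 2 * ENNReal.ofReal ((1 + ‖ξ‖ ^ 2) ^ s)
      ≤ ∫⁻ ξ, (‖𝓕 g ξ‖ₑ ^ 2 + ∑ i, (‖𝓕 g ξ‖ₑ ^ 2 +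
          ∑' k : ℕ, q ^ (k + 1) * (‖𝓕 g ξ‖ₑ ^ 2 * c i k ξ))) := by
        refine lintegral_mono fun ξ ↦ ?_
        refine (mul_le_mul_right ((ofReal_one_add_norm_sq_rpow_le hs (by linarith) ξ).trans
          (add_le_add le_rfl (Finset.sum_le_sum fun i _ ↦
            rpow_le_one_add_tsum_fourierChar hs.le (ξ i)))) _).trans (le_of_eq ?_)
        simp only [mul_add, mul_one, Finset.mul_sum, ← ENNReal.tsum_mul_left, hc]
        simp only [mul_left_comm]
        rfl
    _ = (∫⁻ ξ, ‖𝓕 g ξ‖ₑ ^ 2) + ∑ i, ((∫⁻ ξ, ‖𝓕 g ξ‖ₑ ^ 2) +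
          ∑' k : ℕ, q ^ (k + 1) * ∫⁻ ξ, (‖𝓕 g ξ‖ₑ ^ 2 * c i k ξ)) := by
        have hmk : ∀ i k, Measurable fun ξ ↦ q ^ (k + 1) * (‖𝓕 g ξ‖ₑ ^ 2 * c i k ξ) :=
          fun i k ↦ (hFm.mul (hcm i k)).const_mul _
        have hm : ∀ i, Measurable fun ξ ↦ ‖𝓕 g ξ‖ₑ ^ 2 +
            ∑' k : ℕ, q ^ (k + 1) * (‖𝓕 g ξ‖ₑ ^ 2 * c i k ξ) := fun i ↦
          hFm.add (Measurable.tsum fun k ↦ hmk i k)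
        rw [lintegral_add_left hFm, lintegral_finsetSum _ (fun i _ ↦ hm i)]
        congr 1
        refine Finset.sum_congr rfl fun i _ ↦ ?_
        rw [lintegral_add_left hFm, lintegral_tsum (fun k ↦ (hmk i k).aemeasurable)]
        congr 1
        exact tsum_congr fun k ↦ lintegral_const_mul _ (hFm.mul (hcm i k))
    _ ≤ (∫⁻ ξ, ‖𝓕 g ξ‖ₑ ^ 2) + ∑ i : Fin d, ((∫⁻ ξ, ‖𝓕 g ξ‖ₑ ^ 2) +
          ∑' k : ℕ, q * C * (1 / 2) ^ 2 * (q / 2) ^ k) := by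
        refine add_le_add le_rfl (Finset.sum_le_sum fun i _ ↦ add_le_add le_rfl
          (ENNReal.tsum_le_tsum fun k ↦ ?_))
        refine (mul_le_mul_right (hI i k) _).trans (le_of_eq ?_)
        rw [div_eq_mul_inv q, one_div, mul_pow]
        ring
    _ < ⊤ := by
        refine ENNReal.add_lt_top.2 ⟨hF, ENNReal.sum_lt_top.2 fun i _ ↦
          ENNReal.add_lt_top.2 ⟨hF, ?_⟩⟩
        rw [ENNReal.tsum_mul_left, ENNReal.tsum_geometric]
        refine ENNReal.mul_lt_top (ENNReal.mul_lt_top (ENNReal.mul_lt_top hqt.lt_top hC.lt_top)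
          (by simp)) ?_
        rw [ENNReal.inv_lt_top]
        exact tsub_pos_of_lt hq2

/-! ### Volume of tubes around a hypersurface -/

/-- The tube of radius `r` around a bounded `n`-dimensional Lipschitz image in `ℝ^d` has volume
`O(r^(d-n))`; here the case of codimension one. -/
theorem LipschitzWith.exists_volume_tube_le {n d : ℕ} (hd : d = n + 1)
    {φ : EuclideanSpace ℝ (Fin n) → EuclideanSpace ℝ (Fin d)} {L : NNReal}
    (hφ : LipschitzWith L φ) {B : Set (EuclideanSpace ℝ (Fin n))} (hB : Bornology.IsBounded B) :
    ∃ C : ℝ≥0∞, C ≠ ⊤ ∧ ∀ r : ℝ, 0 < r → r ≤ 1 →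
      volume {x | ∃ u ∈ B, dist x (φ u) ≤ r} ≤ C * ENNReal.ofReal r := by
  -- Radius `2` leaves room for every closed `r`-ball centred in `B`, as `r ≤ 1`.
  set U := Metric.thickening 2 B with hU
  have hUo : IsOpen U := Metric.isOpen_thickening
  have hUt : volume U < ⊤ := hB.thickening.measure_lt_top
  set v := volume (Metric.ball (0 : EuclideanSpace ℝ (Fin n)) 1) with hv
  set w := volume (Metric.ball (0 : EuclideanSpace ℝ (Fin d)) 1) with hw
  have hv0 : v ≠ 0 := (Metric.measure_ball_pos _ _ one_pos).ne'
  have hvt : v ≠ ⊤ := measure_ball_lt_top.ne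
  have hwt : w ≠ ⊤ := measure_ball_lt_top.ne
  refine ⟨v⁻¹ * (ENNReal.ofReal ((1 + L) ^ d) * w * volume U), ?_, fun r hr hr1 ↦ ?_⟩
  · exact ENNReal.mul_ne_top (ENNReal.inv_ne_top.2 hv0)
      (ENNReal.mul_ne_top (ENNReal.mul_ne_top ENNReal.ofReal_ne_top hwt) hUt.ne)
  set T := {x | ∃ u ∈ B, dist x (φ u) ≤ r} with hT
  set R : ℝ := (1 + L) * r with hR
  have hR0 : 0 ≤ R := by positivity
  -- Double counting: the fibre of `Z` over `u` lies in an `R`-ball of `ℝ^d`, while the fibre over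
  -- `x ∈ T` contains an `r`-ball of `ℝ^n`. Hence `r^n |T| ≲ R^d |U|`, and `d = n + 1` leaves one
  -- factor `r`.
  set Z : Set (EuclideanSpace ℝ (Fin d) × EuclideanSpace ℝ (Fin n)) :=
    {p | p.2 ∈ U ∧ dist p.1 (φ p.2) ≤ R} with hZ
  have hZm : MeasurableSet Z := by
    refine (hUo.preimage continuous_snd).measurableSet.inter (IsClosed.measurableSet ?_)
    exact isClosed_le (continuous_fst.dist (hφ.continuous.comp continuous_snd)) continuous_const
  have hupper : (volume.prod volume) Z ≤
      ENNReal.ofReal (R ^ d) * w * volume U := by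
    rw [Measure.prod_apply_symm hZm]
    calc ∫⁻ u, volume ((fun x ↦ (x, u)) ⁻¹' Z)
        ≤ ∫⁻ u, U.indicator (fun _ ↦ ENNReal.ofReal (R ^ d) * w) u := by
          refine lintegral_mono fun u ↦ ?_
          by_cases hu : u ∈ U
          · rw [indicator_of_mem hu]
            have h1 := Measure.addHaar_closedBall volume (φ u) hR0
            rw [finrank_euclideanSpace_fin] at h1
            rw [← h1]
            exact measure_mono fun x hx ↦ hx.2
          · rw [indicator_of_notMem hu]
            have : (fun x ↦ (x, u)) ⁻¹' Z = ∅ := by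
              ext x; simp [hZ, hu]
            simp [this]
      _ = _ := by rw [lintegral_indicator hUo.measurableSet, setLIntegral_const]
  have hlower : ENNReal.ofReal (r ^ n) * v * volume T ≤ (volume.prod volume) Z := by
    rw [Measure.prod_apply hZm]
    refine le_trans ?_ (mul_meas_ge_le_lintegral (measurable_measure_prodMk_left hZm)
      (ENNReal.ofReal (r ^ n) * v))
    gcongr
    rintro x ⟨u, hu, hxu⟩
    have h1 := Measure.addHaar_closedBall volume u hr.le
    rw [finrank_euclideanSpace_fin] at h1
    rw [mem_ofPred_eq, ← h1]
    refine measure_mono fun u' hu' ↦ ⟨?_, ?_⟩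
    · rw [Metric.mem_thickening_iff]
      exact ⟨u, hu, (Metric.mem_closedBall.1 hu').trans_lt (by linarith)⟩
    · have h2 := hφ.dist_le_mul u u'
      have h3 : dist u u' ≤ r := by rw [dist_comm]; exact hu'
      calc dist x (φ u') ≤ dist x (φ u) + dist (φ u) (φ u') := dist_triangle _ _ _
        _ ≤ r + L * r := by gcongr; exact h2.trans (by gcongr)
        _ = R := by rw [hR]; ring
  have hrn0 : ENNReal.ofReal (r ^ n) ≠ 0 := by simp; positivity
  have hfin := hlower.trans hupper
  have e1 : ENNReal.ofReal (R ^ d) =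
      ENNReal.ofReal (r ^ n) * (ENNReal.ofReal ((1 + L) ^ d) * ENNReal.ofReal r) := by
    rw [← ENNReal.ofReal_mul (by positivity), ← ENNReal.ofReal_mul (by positivity), hR, mul_pow, hd]
    congr 1; ring
  rw [e1, mul_assoc, mul_assoc, mul_assoc, ENNReal.mul_le_mul_iff_right hrn0 ENNReal.ofReal_ne_top]
    at hfin
  rw [← ENNReal.mul_le_mul_iff_right hv0 hvt]
  refine hfin.trans (le_of_eq ?_)
  rw [mul_assoc v⁻¹, ENNReal.mul_inv_cancel_left hv0 hvt]
  ring

/-- Each point of an embedded hypersurface has a neighbourhood in it that is contained in the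
image of a bounded set under a Lipschitz map from `ℝ^(d-1)`. -/
theorem IsEmbeddedC2Hypersurface.exists_lipschitzWith {d : ℕ} {S : Set (EuclideanSpace ℝ (Fin d))}
    (hS : IsEmbeddedC2Hypersurface S) {x : EuclideanSpace ℝ (Fin d)} (hx : x ∈ S) :
    ∃ (φ : EuclideanSpace ℝ (Fin (d - 1)) → EuclideanSpace ℝ (Fin d)) (L : NNReal)
      (B : Set (EuclideanSpace ℝ (Fin (d - 1)))),
      LipschitzWith L φ ∧ Bornology.IsBounded B ∧ φ '' B ∈ 𝓝[S] x := by
  obtain ⟨M, _, _, _, ι, hι, rfl⟩ := hS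
  obtain ⟨m, rfl⟩ := hx
  set e := chartAt (EuclideanSpace ℝ (Fin (d - 1))) m with he
  have hsm : ContDiffAt ℝ 2 (ι ∘ e.symm) (e m) := by
    have h1 := (contMDiffAt_iff.1 (hι.contMDiff.contMDiffAt (x := m))).2
    simpa [chartAt_self_eq, contDiffWithinAt_univ] using h1
  obtain ⟨K, t, ht, hK⟩ := (hsm.of_le (by norm_num : (1 : WithTop ℕ∞) ≤ 2)).exists_lipschitzOnWith
  -- The inverse chart followed by `ι` is Lipschitz only near `e m`; the extension makes it global,
  -- possibly with a larger constant.
  obtain ⟨φ, hφ, hφe⟩ := hK.extend_finite_dimension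
  set B := t ∩ e.target ∩ Metric.ball (e m) 1 with hB
  have hBn : B ∈ 𝓝 (e m) :=
    Filter.inter_mem (Filter.inter_mem ht (e.open_target.mem_nhds (mem_chart_target _ m)))
      (Metric.ball_mem_nhds _ one_pos)
  refine ⟨φ, _, B, hφ, Metric.isBounded_ball.subset inter_subset_right, ?_⟩
  have h2 : e.source ∩ e ⁻¹' B ∈ 𝓝 m :=
    Filter.inter_mem (e.open_source.mem_nhds (mem_chart_source _ m))
      ((e.continuousAt (mem_chart_source _ m)).preimage_mem_nhds hBn)
  rw [← hι.isEmbedding.map_nhds_eq]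
  refine Filter.mem_of_superset (Filter.image_mem_map h2) ?_
  rintro _ ⟨y, ⟨hy1, hy2⟩, rfl⟩
  refine ⟨e y, hy2, ?_⟩
  rw [← hφe hy2.1.1, Function.comp_apply, e.left_inv hy1]

/-- The bound passes to subsets and finite unions, so compactness reduces it to the local Lipschitz
patches. -/
theorem IsEmbeddedC2Hypersurface.exists_volume_cthickening_le {d : ℕ} (hd : 1 ≤ d)
    {S : Set (EuclideanSpace ℝ (Fin d))} (hS : IsEmbeddedC2Hypersurface S) (hc : IsCompact S) :
    ∃ C : ℝ≥0∞, C ≠ ⊤ ∧ ∀ r : ℝ, 0 < r → r ≤ 1 →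
      volume (Metric.cthickening r S) ≤ C * ENNReal.ofReal r := by
  suffices h : ∃ C : ℝ≥0∞, C ≠ ⊤ ∧ ∀ r : ℝ, 0 < r → r ≤ 1 →
      volume {x | ∃ y ∈ S, dist x y ≤ r} ≤ C * ENNReal.ofReal r by
    obtain ⟨C, hC, h⟩ := h
    refine ⟨C, hC, fun r hr hr1 ↦ (measure_mono ?_).trans (h r hr hr1)⟩
    rw [hc.cthickening_eq_biUnion_closedBall hr.le]
    intro x hx
    simpa using hx
  refine hc.induction_on (p := fun S ↦ ∃ C : ℝ≥0∞, C ≠ ⊤ ∧ ∀ r : ℝ, 0 < r → r ≤ 1 →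
      volume {x | ∃ y ∈ S, dist x y ≤ r} ≤ C * ENNReal.ofReal r) ⟨0, by simp, by simp⟩ ?_ ?_ ?_
  · rintro s t hst ⟨C, hC, h⟩
    refine ⟨C, hC, fun r hr hr1 ↦ le_trans (measure_mono ?_) (h r hr hr1)⟩
    rintro x ⟨y, hy, hxy⟩
    exact ⟨y, hst hy, hxy⟩
  · rintro s t ⟨C, hC, h⟩ ⟨C', hC', h'⟩
    refine ⟨C + C', by simp [hC, hC'], fun r hr hr1 ↦ ?_⟩
    rw [add_mul]
    refine le_trans (measure_mono ?_) ((measure_union_le _ _).trans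
      (add_le_add (h r hr hr1) (h' r hr hr1)))
    rintro x ⟨y, hy | hy, hxy⟩
    exacts [Or.inl ⟨y, hy, hxy⟩, Or.inr ⟨y, hy, hxy⟩]
  · intro x hx
    obtain ⟨φ, L, B, hφ, hB, hn⟩ := hS.exists_lipschitzWith hx
    obtain ⟨C, hC, h⟩ := hφ.exists_volume_tube_le (by omega) hB
    refine ⟨φ '' B, hn, C, hC, fun r hr hr1 ↦ ?_⟩
    simpa using h r hr hr1

/-! ### Translation modulus of the cut-off function -/

/-- By connectedness of `[0, 1]`, the preimage of `D` along the segment, neither empty nor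
everything, has a frontier point. -/
theorem exists_mem_segment_frontier {E : Type*} [AddCommGroup E] [Module ℝ E] [TopologicalSpace E]
    [ContinuousAdd E] [ContinuousSMul ℝ E] {D : Set E} {x y : E} (hx : x ∈ D) (hy : y ∉ D) :
    ∃ t ∈ Icc (0 : ℝ) 1, x + t • (y - x) ∈ frontier D := by
  set f : Icc (0 : ℝ) 1 → E := fun t ↦ x + (t : ℝ) • (y - x) with hf
  have hfc : Continuous f := by fun_prop
  obtain ⟨t, ht⟩ : (frontier (f ⁻¹' D)).Nonempty := nonempty_frontier_iff.2
    ⟨⟨⟨0, by simp⟩, by simpa [hf] using hx⟩, fun h ↦ hy (by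
      simpa [hf] using (h.symm.subset (mem_univ (⟨1, by simp⟩ : Icc (0 : ℝ) 1))))⟩
  exact ⟨t, t.2, hfc.frontier_preimage_subset _ ht⟩

theorem mem_cthickening_frontier_of_mem_of_notMem {d : ℕ} {D : Set (EuclideanSpace ℝ (Fin d))}
    {x y : EuclideanSpace ℝ (Fin d)} (hx : x ∈ D) (hy : y ∉ D) :
    x ∈ Metric.cthickening (dist x y) (frontier D) ∧
      y ∈ Metric.cthickening (dist x y) (frontier D) := by
  obtain ⟨t, ⟨ht0, ht1⟩, ht⟩ := exists_mem_segment_frontier hx hy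
  constructor <;> refine Metric.mem_cthickening_of_dist_le _ _ _ _ ht ?_
  · rw [dist_self_add_right, norm_smul, Real.norm_of_nonneg ht0, dist_comm, dist_eq_norm]
    exact mul_le_of_le_one_left (norm_nonneg _) ht1
  · rw [dist_eq_norm, show y - (x + t • (y - x)) = (1 - t) • (y - x) by module, norm_smul,
      Real.norm_of_nonneg (by linarith), dist_comm, dist_eq_norm]
    exact mul_le_of_le_one_left (norm_nonneg _) (by linarith)

theorem exists_lintegral_translate_indicator_le {d : ℕ} (hd : 1 ≤ d)
    {f : EuclideanSpace ℝ (Fin d) → ℂ} (hf : ContDiff ℝ 1 f)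
    {D : Set (EuclideanSpace ℝ (Fin d))} (hD : IsCompact D) (hc : IsCompact (frontier D))
    (hS : IsEmbeddedC2Hypersurface (frontier D)) :
    ∃ C : ℝ≥0∞, C ≠ ⊤ ∧ ∀ y : EuclideanSpace ℝ (Fin d), ‖y‖ ≤ 1 →
      ∫⁻ x, ‖D.indicator f (x + y) - D.indicator f x‖ₑ ^ 2 ≤ C * ‖y‖ₑ := by
  obtain ⟨C, hC, htube⟩ := hS.exists_volume_cthickening_le hd hc
  obtain ⟨M, hM⟩ := hD.exists_bound_of_continuousOn hf.continuous.continuousOn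
  -- `D` need not be convex, so the Lipschitz constant is taken on a ball containing it.
  obtain ⟨ρ, hρ⟩ := hD.isBounded.subset_closedBall (0 : EuclideanSpace ℝ (Fin d))
  obtain ⟨L, hL⟩ := hf.contDiffOn.exists_lipschitzOnWith one_ne_zero
    (convex_closedBall (0 : EuclideanSpace ℝ (Fin d)) ρ) (isCompact_closedBall _ _)
  refine ⟨L ^ 2 * volume D + ENNReal.ofReal M ^ 2 * C, ?_, fun y hy ↦ ?_⟩
  · have := hD.measure_lt_top (μ := volume) |>.ne
    finiteness
  rcases eq_or_ne y 0 with rfl | hy0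
  · simp
  have hypos : 0 < ‖y‖ := norm_pos_iff.2 hy0
  have hye : ENNReal.ofReal ‖y‖ = ‖y‖ₑ := ofReal_norm y
  set N := Metric.cthickening ‖y‖ (frontier D) with hN
  have hMe : ∀ x ∈ D, ‖f x‖ₑ ≤ ENNReal.ofReal M := fun x hx ↦ by
    rw [← ofReal_norm]; exact ENNReal.ofReal_le_ofReal (hM x hx)
  have hcross : ∀ x z, x ∈ D → z ∉ D → dist x z = ‖y‖ → x ∈ N ∧ z ∈ N := fun x z hx hz h ↦ by
    rw [hN, ← h]; exact mem_cthickening_frontier_of_mem_of_notMem hx hz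
  calc ∫⁻ x, ‖D.indicator f (x + y) - D.indicator f x‖ₑ ^ 2
      ≤ ∫⁻ x, (D.indicator (fun _ ↦ (L * ‖y‖ₑ) ^ 2) x
          + N.indicator (fun _ ↦ ENNReal.ofReal M ^ 2) x) := by
        refine lintegral_mono fun x ↦ ?_
        by_cases h1 : x ∈ D <;> by_cases h2 : x + y ∈ D
        · refine le_trans ?_ le_self_add
          simp only [h1, h2, indicator_of_mem]
          gcongr
          have := hL (hρ h2) (hρ h1)
          rwa [edist_eq_enorm_sub, edist_eq_enorm_sub, add_sub_cancel_left] at this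
        · refine le_trans ?_ le_add_self
          have h3 := (hcross x (x + y) h1 h2 (by simp)).1
          simp only [h1, h2, h3, indicator_of_mem, not_false_eq_true, indicator_of_notMem,
            zero_sub, enorm_neg]
          gcongr
          exact hMe x h1
        · refine le_trans ?_ le_add_self
          have h3 := (hcross (x + y) x h2 h1 (by simp)).2
          simp only [h1, h2, h3, indicator_of_mem, not_false_eq_true, indicator_of_notMem, sub_zero]
          gcongr
          exact hMe _ h2
        · simp [h1, h2]
    _ = (L * ‖y‖ₑ) ^ 2 * volume D + ENNReal.ofReal M ^ 2 * volume N := by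
        rw [lintegral_add_left (measurable_const.indicator hD.measurableSet),
          lintegral_indicator hD.measurableSet,
          lintegral_indicator Metric.isClosed_cthickening.measurableSet, setLIntegral_const,
          setLIntegral_const]
    _ ≤ L ^ 2 * ‖y‖ₑ * volume D + ENNReal.ofReal M ^ 2 * (C * ‖y‖ₑ) := by
        have h1 : ‖y‖ₑ ≤ 1 := by
          rw [← hye]; exact ENNReal.ofReal_le_one.2 hy
        gcongr
        · rw [mul_pow, sq ‖y‖ₑ]
          gcongr
          exact mul_le_of_le_one_left zero_le h1
        · rw [← hye]; exact htube _ hypos hy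
    _ = _ := by ring

/-! ### Sobolev spaces and conclusion -/

theorem memLp_indicator_of_isCompact {d : ℕ} {f : EuclideanSpace ℝ (Fin d) → ℂ}
    (hf : Continuous f) {D : Set (EuclideanSpace ℝ (Fin d))} (hD : IsCompact D) (p : ℝ≥0∞) :
    MemLp (D.indicator f) p := by
  obtain ⟨M, hM⟩ := hD.exists_bound_of_continuousOn hf.continuousOn
  rw [memLp_indicator_iff_restrict hD.measurableSet]
  have : IsFiniteMeasure (volume.restrict D) := ⟨by simpa using hD.measure_lt_top⟩
  exact MemLp.of_bound hf.aestronglyMeasurable M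
    ((ae_restrict_iff' hD.measurableSet).2 (Filter.Eventually.of_forall hM))

theorem sobolevENorm_lt_top_iff {d : ℕ} {s : ℝ}
    {f : Lp ℂ 2 (volume : Measure (EuclideanSpace ℝ (Fin d)))} :
    sobolevENorm s f < ⊤ ↔ ∫⁻ ξ : EuclideanSpace ℝ (Fin d),
      ‖(𝓕 f : Lp ℂ 2 (volume : Measure (EuclideanSpace ℝ (Fin d)))) ξ‖ₑ ^ 2 *
        ENNReal.ofReal ((1 + ‖ξ‖ ^ 2) ^ s) < ⊤ :=
  ENNReal.rpow_lt_top_iff_of_pos (by norm_num)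

theorem sobolevSpace_anti {d : ℕ} {s t : ℝ} (hst : s ≤ t) : sobolevSpace d t ⊆ sobolevSpace d s := by
  rintro f ⟨hf, h⟩
  refine ⟨hf, sobolevENorm_lt_top_iff.2 (lt_of_le_of_lt ?_ (sobolevENorm_lt_top_iff.1 h))⟩
  gcongr
  simp

theorem sobolevSpace_add {d : ℕ} {s : ℝ} {f g : EuclideanSpace ℝ (Fin d) → ℂ}
    (hf : f ∈ sobolevSpace d s) (hg : g ∈ sobolevSpace d s) : f + g ∈ sobolevSpace d s := by
  obtain ⟨hf, hf'⟩ := hf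
  obtain ⟨hg, hg'⟩ := hg
  rw [sobolevENorm_lt_top_iff] at hf' hg'
  refine ⟨hf.add hg, sobolevENorm_lt_top_iff.2 ?_⟩
  rw [MemLp.toLp_add hf hg, FourierTransform.fourier_add]
  have hm : Measurable fun ξ : EuclideanSpace ℝ (Fin d) ↦ ENNReal.ofReal ((1 + ‖ξ‖ ^ 2) ^ s) := by
    fun_prop
  calc _ ≤ ∫⁻ ξ, (2 * (‖𝓕 (hf.toLp f) ξ‖ₑ ^ 2 * ENNReal.ofReal ((1 + ‖ξ‖ ^ 2) ^ s)) +
        2 * (‖𝓕 (hg.toLp g) ξ‖ₑ ^ 2 * ENNReal.ofReal ((1 + ‖ξ‖ ^ 2) ^ s))) := by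
        refine lintegral_mono_ae ?_
        filter_upwards [Lp.coeFn_add (𝓕 (hf.toLp f)) (𝓕 (hg.toLp g))] with ξ hξ
        rw [hξ, Pi.add_apply, ← mul_assoc, ← mul_assoc, ← add_mul, ← mul_add]
        gcongr
        refine (pow_le_pow_left₀ zero_le (enorm_add_le _ _) 2).trans ?_
        have := ENNReal.rpow_add_le_mul_rpow_add_rpow ‖𝓕 (hf.toLp f) ξ‖ₑ ‖𝓕 (hg.toLp g) ξ‖ₑ
          one_le_two
        norm_num at this
        exact this
    _ < ⊤ := by
        rw [lintegral_add_left', lintegral_const_mul'' , lintegral_const_mul'']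
        · finiteness
        all_goals
          have := (Lp.aestronglyMeasurable (𝓕 (hf.toLp f))).enorm
          have := (Lp.aestronglyMeasurable (𝓕 (hg.toLp g))).enorm
          fun_prop

theorem mainTheorem5 (d : ℕ) (hd : 1 ≤ d) (K : ℝ) (hK : 0 < K) (s : ℝ)
    (hs : s ∈ Set.Ioo (0 : ℝ) (1 / 2)) :
    cartoonClass d K ⊆ sobolevSpace d s := by
  rintro _ ⟨f₁, f₂, D, rfl, hD, hc, hS, hf₁, -, -, hf₂, -, -, -, -⟩
  refine sobolevSpace_add (sobolevSpace_anti hs.2.le hf₁) ?_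
  have h2 := memLp_indicator_of_isCompact hf₂.continuous hD 2
  have h1 := memLp_one_iff_integrable.1 (memLp_indicator_of_isCompact hf₂.continuous hD 1)
  obtain ⟨C, hC, h⟩ := exists_lintegral_translate_indicator_le hd hf₂ hD hc hS
  refine ⟨h2, sobolevENorm_lt_top_iff.2 ?_⟩
  refine lt_of_eq_of_lt (lintegral_congr_ae ?_)
    (lintegral_fourier_sq_mul_lt_top hs.1 hs.2 h1 h2 hC h)
  filter_upwards [Lp.fourier_toLp_ae_eq h1 h2] with ξ hξ
  rw [hξ]
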